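/- Let $\alpha\in\mathbb C$, $\theta\in\mathbb R$ and $p\in\mathbb N=\{0,1,2,\dots\}$. For a power series $\omega(\xi)=\sum_{j\ge 0}\omega_j\xi^j$ with complex coefficients, the shifted convolution quadrature (SCQ) with shift $\theta$ generated by $\omega$ has, at the node $x=(n-\theta)h$ with $h>0$, the convolution part $$(\Omega_h^\alpha f)(x)=h^\alpha\sum_{j=0}^{n}\omega_j\,f\big(x+(\theta-j)h\big),$$ and its error is $E_h^\alpha=\Omega_h^\alpha-I^\alpha$, where $I^\alpha$ is the Riemann–Liouville operator. For $\operatorname{Re}\beta\le 0$ the value $(I^\alpha t^{\beta-1})(1)$ is understood by analytic continuation in $\beta$, and the value of $t^{\beta-1}$ at $t=0$ is taken to be $0$ if $\beta\ne 1$ and $1$ if $\beta=1$. The SCQ is called convergent of order $p$ (to $I^\alpha$) if $$(E_h^\alpha t^{\beta-1})(1)=O(h^\beta)+O(h^p)\quad\text{for all }\beta\in\mathbb C,\ \beta\ne 0,-1,-2,\dots,$$ as $h\to0$ through the step sizes $h=1/(n-\theta)$, for which $1$ is the node $(n-\theta)h$. A convolution quadrature (CQ) is an SCQ with $\theta=0$.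 Suppose that $\varpi_p(\xi)$ is the generating function of a CQ that is convergent of order $p$ to $I^\alpha$. Define $$\omega(\xi)=\varpi_p(\xi)\big[\gamma''_0+\gamma''_1(1-\xi)+\cdots+\gamma''_{p-1}(1-\xi)^{p-1}\big],$$ where the coefficients $\gamma''_i$ are given by $\sum_{i=0}^{\infty}\gamma''_i(1-\xi)^i=\xi^{\theta}$ for $\xi$ near $1$ (principal branch). Then the SCQ with shift $\theta$ whose convolution weights are generated by $\omega(\xi)$ is convergent of order $p$ to $I^\alpha$. -/

import Mathlib

open Filter Topology Asymptotics

noncomputable section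

/-- The Riemann–Liouville integral
`(1 / Γ(α)) ∫_0^x (x - s)^(α - 1) f(s) ds`, used for `0 < Re α`. -/
def rlIntegral (α : ℂ) (f : ℝ → ℂ) (x : ℝ) : ℂ :=
  (1 / Complex.Gamma α) * ∫ s in (0 : ℝ)..x, ((x : ℂ) - (s : ℂ)) ^ (α - 1) * f s

open Classical in
/-- The Riemann–Liouville operator `I^α` for arbitrary `α ∈ ℂ`: the identity for `α = 0`, the
Riemann–Liouville integral for `0 < Re α`, and otherwise `(d/dx)^n I^(n + α)` where
`n = ⌊-Re α⌋ + 1`. This `n` is the ceiling of `-Re α` unless `Re α` is an integer; in that case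
it is one more, so that `0 < Re (n + α)` always. -/
def rlOperator (α : ℂ) (f : ℝ → ℂ) (x : ℝ) : ℂ :=
  if α = 0 then f x
  else if 0 < α.re then rlIntegral α f x
  else iteratedDeriv (⌊-α.re⌋₊ + 1) (rlIntegral (((⌊-α.re⌋₊ + 1 : ℕ) : ℂ) + α) f) x

/-- The function `t ↦ t^(β - 1)` on `t ≥ 0`. At `t = 0` its value is `0`, except that it is `1`
for `β = 1`. -/
def powerFun (β : ℂ) (t : ℝ) : ℂ := (t : ℂ) ^ (β - 1)

/-- The exponents `β ∈ ℂ` with `β ≠ 0, -1, -2, …`. -/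
def admissibleExponents : Set ℂ := {β | ∀ k : ℕ, β ≠ -(k : ℂ)}

/-- `F` is the analytic continuation of `β ↦ (I^α t^(β - 1))(x)` from the half-plane `0 < Re β`,
where the integral converges, to all `β ≠ 0, -1, -2, …`. -/
def IsRLPowerContinuation (α : ℂ) (x : ℝ) (F : ℂ → ℂ) : Prop :=
  DifferentiableOn ℂ F admissibleExponents ∧
    ∀ β : ℂ, 0 < β.re → F β = rlOperator α (powerFun β) x

/-- `(I^α t^(β - 1))(x)` for `x > 0` and every `β ≠ 0, -1, -2, …` (for `Re β ≤ 0` in the sense of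
analytic continuation in `β`, that is, of Hadamard's finite part). -/
def rlPower (α β : ℂ) (x : ℝ) : ℂ := Classical.epsilon (IsRLPowerContinuation α x) β

theorem rlIntegral_powerFun {a b : ℂ} (ha : 0 < a.re) (hb : 0 < b.re) {x : ℝ} (hx : 0 < x) :
    rlIntegral a (powerFun b) x
      = Complex.Gamma b / Complex.Gamma (a + b) * (x : ℂ) ^ (a + b - 1) := by
  have h1 : (∫ s in (0 : ℝ)..x, ((x : ℂ) - (s : ℂ)) ^ (a - 1) * powerFun b s)
      = (x : ℂ) ^ (b + a - 1) * Complex.betaIntegral b a := by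
    rw [← Complex.betaIntegral_scaled b a hx]
    congr 1
    funext s
    simp only [powerFun]
    ring
  have hne : Complex.Gamma a ≠ 0 := Complex.Gamma_ne_zero_of_re_pos ha
  have hne' : Complex.Gamma (a + b) ≠ 0 :=
    Complex.Gamma_ne_zero_of_re_pos (by rw [Complex.add_re]; linarith)
  have h2 := Complex.Gamma_mul_Gamma_eq_betaIntegral hb ha
  rw [add_comm b a] at h1 h2
  rw [rlIntegral, h1]
  field_simp
  linear_combination (-(x : ℂ) ^ (a + b - 1)) * h2

theorem iteratedDeriv_power (K : ℂ) (g : ℝ → ℂ) (c : ℂ)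
    (hg : ∀ x : ℝ, 0 < x → g x = K / Complex.Gamma (c + 1) * (x : ℂ) ^ c) (n : ℕ) :
    ∀ x : ℝ, 0 < x →
      iteratedDeriv n g x = K / Complex.Gamma (c - n + 1) * (x : ℂ) ^ (c - n) := by
  induction n with
  | zero => intro x hx; simpa using hg x hx
  | succ n ih =>
    intro x hx
    rw [iteratedDeriv_succ]
    have he : iteratedDeriv n g =ᶠ[𝓝 x]
        fun y : ℝ => K / Complex.Gamma (c - n + 1) * (y : ℂ) ^ (c - n) := by
      filter_upwards [lt_mem_nhds hx] with y hy using ih y hy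
    rw [he.deriv_eq]
    have hd : HasDerivAt (fun y : ℝ => K / Complex.Gamma (c - n + 1) * (y : ℂ) ^ (c - n))
        (K / Complex.Gamma (c - n + 1) * ((c - n) * (x : ℂ) ^ (c - n - 1))) x := by
      have h0 : HasDerivAt (fun z : ℂ => z ^ (c - n)) ((c - n) * (x : ℂ) ^ (c - n - 1)) (x : ℂ) := by
        simpa using (hasDerivAt_id (x : ℂ)).cpow_const (c := c - n)
          (Or.inl (by simpa using hx))
      exact (h0.comp_ofReal).const_mul _
    rw [hd.deriv]
    have hG := Complex.one_div_Gamma_eq_self_mul_one_div_Gamma_add_one (c - n)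
    have e1 : c - ((n + 1 : ℕ) : ℂ) + 1 = c - n := by push_cast; ring
    have e2 : c - ((n + 1 : ℕ) : ℂ) = c - n - 1 := by push_cast; ring
    rw [e1, e2, div_eq_mul_inv K (Complex.Gamma (c - n)), hG]
    ring

theorem rlOperator_powerFun {α b : ℂ} (hb : 0 < b.re) {x : ℝ} (hx : 0 < x) :
    rlOperator α (powerFun b) x
      = Complex.Gamma b / Complex.Gamma (α + b) * (x : ℂ) ^ (α + b - 1) := by
  unfold rlOperator
  split_ifs with h0 h1
  · have : Complex.Gamma b ≠ 0 := Complex.Gamma_ne_zero_of_re_pos hb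
    simp [h0, powerFun, this]
  · exact rlIntegral_powerFun h1 hb hx
  · set n : ℕ := ⌊-α.re⌋₊ + 1 with hn
    have hpos : 0 < ((n : ℂ) + α).re := by
      have := Nat.lt_floor_add_one (-α.re)
      simp only [hn, Complex.add_re, Complex.natCast_re]
      push_cast
      linarith
    have := iteratedDeriv_power (Complex.Gamma b) (rlIntegral ((n : ℂ) + α) (powerFun b))
      ((n : ℂ) + α + b - 1) (fun y hy => by
        rw [rlIntegral_powerFun hpos hb hy]; congr 3; ring) n x hx
    rw [this]
    have e1 : (n : ℂ) + α + b - 1 - n + 1 = α + b := by ring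
    have e2 : (n : ℂ) + α + b - 1 - n = α + b - 1 := by ring
    rw [e1, e2]

theorem admissibleExponents_eq :
    admissibleExponents = (Set.range fun k : ℕ => -(k : ℂ))ᶜ := by
  ext β
  simp only [admissibleExponents, Set.mem_ofPred_eq, Set.mem_compl_iff, Set.mem_range, not_exists]
  exact forall_congr' fun k => ⟨fun h h' => h h'.symm, fun h h' => h h'.symm⟩

theorem isOpen_admissibleExponents : IsOpen admissibleExponents := by
  rw [admissibleExponents_eq, isOpen_compl_iff]
  have h : Topology.IsClosedEmbedding (fun k : ℕ => -(k : ℂ)) := by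
    refine Topology.IsClosedEmbedding.comp (Homeomorph.neg ℂ).isClosedEmbedding ?_
    refine Metric.isClosedEmbedding_of_pairwise_le_dist zero_lt_one fun i j hij => ?_
    change (1 : ℝ) ≤ dist (i : ℂ) (j : ℂ)
    rw [Complex.dist_eq, ← Complex.ofReal_natCast, ← Complex.ofReal_natCast,
      ← Complex.ofReal_sub, Complex.norm_real, Real.norm_eq_abs, ← Real.dist_eq]
    exact Nat.pairwise_one_le_dist hij
  exact h.isClosed_range

/-- The continuation exists for `x > 0`, and its value is
`Γ(β) / Γ(α + β) * x^(α + β - 1)`, where `1 / Γ` vanishes at the poles of `Γ`. -/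
theorem rlPower_eq (α : ℂ) {x : ℝ} (hx : 0 < x) :
    IsRLPowerContinuation α x (rlPower α · x) ∧ ∀ β ∈ admissibleExponents, rlPower α β x
      = Complex.Gamma β / Complex.Gamma (α + β) * (x : ℂ) ^ (α + β - 1) := by
  have hx' : (x : ℂ) ≠ 0 := by exact_mod_cast hx.ne'
  have hG : IsRLPowerContinuation α x
      (fun β => Complex.Gamma β / Complex.Gamma (α + β) * (x : ℂ) ^ (α + β - 1)) := by
    refine ⟨fun β hβ => DifferentiableAt.differentiableWithinAt ?_,
      fun β hβ => (rlOperator_powerFun hβ hx).symm⟩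
    have h1 : DifferentiableAt ℂ (fun β => (Complex.Gamma (α + β))⁻¹) β :=
      (Complex.differentiable_one_div_Gamma.comp (differentiable_id.const_add α)) β
    have h2 := Complex.differentiableAt_Gamma β hβ
    have h3 : DifferentiableAt ℂ (fun β : ℂ => (x : ℂ) ^ (α + β - 1)) β :=
      DifferentiableAt.const_cpow (by fun_prop) (Or.inl hx')
    simp only [div_eq_mul_inv]
    exact (h2.mul h1).mul h3
  have hF : IsRLPowerContinuation α x (Classical.epsilon (IsRLPowerContinuation α x)) :=
    Classical.epsilon_spec ⟨_, hG⟩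
  refine ⟨hF, ?_⟩
  have h1 : (1 : ℂ) ∈ admissibleExponents := by
    intro k hk
    have := congrArg Complex.re hk
    simp at this
    have := Nat.cast_nonneg (α := ℝ) k
    linarith
  have hpc : IsPreconnected admissibleExponents := by
    rw [admissibleExponents_eq]
    exact (Set.Countable.isPathConnected_compl_of_one_lt_rank (by simp)
      (Set.countable_range _)).isConnected.isPreconnected
  refine (hF.1.analyticOnNhd isOpen_admissibleExponents).eqOn_of_preconnected_of_eventuallyEq
    (hG.1.analyticOnNhd isOpen_admissibleExponents) hpc h1 ?_
  have : {z : ℂ | 0 < z.re} ∈ 𝓝 (1 : ℂ) :=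
    (isOpen_lt continuous_const Complex.continuous_re).mem_nhds (by simp)
  filter_upwards [this] with z hz
  exact (hF.2 z hz).trans (hG.2 z hz).symm

/-- The convolution part `(Ω_h^α f)(x) = h^α ∑_{j=0}^n ω_j f(x + (θ - j) h)` of the shifted
convolution quadrature with generating function `ω`, at the node `x = (n - θ) h`. -/
def convPart (α : ℂ) (θ : ℝ) (ω : PowerSeries ℂ) (h : ℝ) (n : ℕ) (f : ℝ → ℂ) : ℂ :=
  (h : ℂ) ^ α *
    ∑ j ∈ Finset.range (n + 1),
      PowerSeries.coeff j ω * f (((n : ℝ) - θ) * h + (θ - (j : ℝ)) * h)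

/-- The step size `h` for which the `n`-th shifted node `(n - θ) h` is the point `1`. -/
def unitStep (θ : ℝ) (n : ℕ) : ℝ := 1 / ((n : ℝ) - θ)

/-- The convolution quadrature error `(E_h^α t^(β - 1))(1)`, where `E_h^α = Ω_h^α - I^α` and
`1 = (n - θ) h`. -/
def convError (α : ℂ) (θ : ℝ) (ω : PowerSeries ℂ) (β : ℂ) (n : ℕ) : ℂ :=
  convPart α θ ω (unitStep θ n) n (powerFun β) - rlPower α β 1

/-- The shifted convolution quadrature with shift `θ` and generating function `ω` is convergent
of order `p` to `I^α`: `(E_h^α t^(β - 1))(1) = O(h^β) + O(h^p)` as `h → 0`, for every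
`β ≠ 0, -1, -2, …`. The starting weights play no role. -/
def SCQConvergent (α : ℂ) (θ : ℝ) (ω : PowerSeries ℂ) (p : ℕ) : Prop :=
  ∀ β ∈ admissibleExponents,
    (fun n : ℕ => convError α θ ω β n) =O[atTop]
      (fun n : ℕ => (unitStep θ n) ^ β.re + (unitStep θ n) ^ p)

/-- Convergence of order `p` of a convolution quadrature: the case without shift. -/
def CQConvergent (α : ℂ) (ω : PowerSeries ℂ) (p : ℕ) : Prop :=
  SCQConvergent α 0 ω p

/-- The generating function `ϖ(ξ) (γ_0 + γ_1 (1 - ξ) + ⋯ + γ_{p-1} (1 - ξ)^(p-1))`. -/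
def shiftedGen (ϖ : PowerSeries ℂ) (γ : ℕ → ℂ) (p : ℕ) : PowerSeries ℂ :=
  ϖ * ∑ i ∈ Finset.range p, PowerSeries.C (γ i) * (1 - PowerSeries.X) ^ i

end

/-! At the node `1` the convolution part is `h^(α+β-1)` times the `n`-th coefficient of `ω(ξ) ∑
m^(β-1) ξ^m`, so convergence says that this coefficient is `Γ(β)/Γ(α+β) (n-θ)^(α+β-1)` up to
`O(n^(Re α-1)) + O(n^(Re(α+β)-1-p))` (`isBigO_convError_iff`). Multiplying `ϖ` by the polynomial
`Q(ξ) = ∑ q_j ξ^j` replaces the coefficients `c_n` by the finite sum `∑ q_j c_(n-j)`, which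
preserves the error rate. What remains is `∑ q_j (n-j)^c = (n-θ)^c + O(n^(Re c-p))` with `c =
α+β-1`. By the binomial series in `1/n` this follows from the moment conditions `∑ q_j j^k = θ^k`,
`k < p`, and these are the Taylor coefficients at `u = 0` of `Q(e^u) = e^(θu) + O(u^p)`, the
defining property of `Q` at `ξ = e^u`. -/

/-! ### Moment conditions from exponentials to powers -/

theorem natCast_le_analyticOrderAt_of_isBigO {f : ℂ → ℂ} (hf : AnalyticAt ℂ f 0) {p : ℕ}
    (h : f =O[𝓝 0] fun z => z ^ p) : (p : ℕ∞) ≤ analyticOrderAt f 0 := by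
  by_contra! hlt
  obtain ⟨m, hm⟩ := ENat.ne_top_iff_exists.1 hlt.ne_top
  rw [← hm, Nat.cast_lt] at hlt
  obtain ⟨g, hg, hg0, hfg⟩ := (hf.analyticOrderAt_eq_natCast).1 hm.symm
  obtain ⟨C, hC⟩ := h.bound
  -- With `f = z^m g` and `m < p`, dividing by `|z|^m` off the origin forces `g 0 = 0`, a
  -- contradiction.
  have hev : ∀ᶠ z in 𝓝[≠] (0 : ℂ), ‖g z‖ ≤ C * ‖z‖ ^ (p - m) := by
    filter_upwards [hfg.filter_mono nhdsWithin_le_nhds, hC.filter_mono nhdsWithin_le_nhds,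
      self_mem_nhdsWithin] with z h1 h2 h3
    have hz : 0 < ‖z‖ := norm_pos_iff.2 h3
    rw [h1, sub_zero, norm_smul, norm_pow, norm_pow, ← Nat.sub_add_cancel hlt.le, pow_add] at h2
    have := pow_pos hz m
    refine le_of_mul_le_mul_left ?_ this
    linarith
  have h1 : Tendsto (fun z => ‖g z‖) (𝓝[≠] (0 : ℂ)) (𝓝 ‖g 0‖) :=
    (hg.continuousAt.norm.tendsto).mono_left nhdsWithin_le_nhds
  have h2 : Tendsto (fun z : ℂ => C * ‖z‖ ^ (p - m)) (𝓝[≠] (0 : ℂ)) (𝓝 0) := by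
    have hc : Continuous fun z : ℂ => C * ‖z‖ ^ (p - m) := by fun_prop
    have := hc.tendsto 0
    simp only [norm_zero, zero_pow (Nat.sub_ne_zero_of_lt hlt), mul_zero] at this
    exact this.mono_left nhdsWithin_le_nhds
  exact hg0 (norm_le_zero_iff.1 (le_of_tendsto_of_tendsto h1 h2 hev))

theorem iteratedDeriv_eq_zero_of_isBigO {f : ℂ → ℂ} (hf : AnalyticAt ℂ f 0) {p : ℕ}
    (h : f =O[𝓝 0] fun z => z ^ p) {k : ℕ} (hk : k < p) : iteratedDeriv k f 0 = 0 :=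
  (natCast_le_analyticOrderAt_iff_iteratedDeriv_eq_zero hf).1
    (natCast_le_analyticOrderAt_of_isBigO hf h) k hk

/-- If `∑ a_j e^{μ_j u}` agrees with `e^{ν u}` up to `O(u^p)`, the moments of order `k < p`
of the weights `a` at the nodes `μ` are `ν ^ k`. -/
theorem sum_mul_pow_eq_of_isBigO_exp {ι : Type*} (s : Finset ι) (a μ : ι → ℂ) (ν : ℂ) {p : ℕ}
    (h : (fun u : ℂ => ∑ i ∈ s, a i * Complex.exp (μ i * u) - Complex.exp (ν * u))
      =O[𝓝 0] fun u => u ^ p) {k : ℕ} (hk : k < p) :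
    ∑ i ∈ s, a i * μ i ^ k = ν ^ k := by
  have hd (c : ℂ) : ContDiff ℂ k fun u : ℂ => Complex.exp (c * u) := by fun_prop
  have h0 := iteratedDeriv_eq_zero_of_isBigO (by fun_prop) h hk
  rw [iteratedDeriv_fun_sub (ContDiff.contDiffAt (by fun_prop)) (hd ν).contDiffAt,
    iteratedDeriv_fun_sum (fun i _ => ContDiff.contDiffAt (by fun_prop))] at h0
  simpa [iteratedDeriv_const_mul_field, iteratedDeriv_cexp_const_mul, sub_eq_zero] using h0

theorem isBigO_one_sub_mul_cpow_sub_sum (c μ : ℂ) (p : ℕ) :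
    (fun t : ℂ => (1 - μ * t) ^ c - ∑ k ∈ Finset.range p, Ring.choose c k * (-(μ * t)) ^ k)
      =O[𝓝 0] fun t => t ^ p := by
  have h := (Complex.one_add_cpow_hasFPowerSeriesAt_zero (a := c)).isBigO_sub_partialSum_pow p
  have ht : Tendsto (fun t : ℂ => -(μ * t)) (𝓝 0) (𝓝 0) := by
    have hc : Continuous fun t : ℂ => -(μ * t) := by fun_prop
    simpa using hc.tendsto 0
  have h2 := h.comp_tendsto ht
  refine IsBigO.trans (h2.congr_left fun t => ?_) (IsBigO.of_bound (‖μ‖ ^ p) (.of_forall ?_))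
  · simp [FormalMultilinearSeries.partialSum, binomialSeries, sub_eq_add_neg, mul_comm]
  · intro t
    simp [mul_pow]

/-- If the moments of order `k < p` of the weights `a` at the nodes `μ` are `ν ^ k`, then
`∑ a_j (1 - μ_j t)^c` agrees with `(1 - ν t)^c` up to `O(t^p)`. -/
theorem isBigO_sum_cpow_sub_of_sum_mul_pow_eq {ι : Type*} (s : Finset ι) (a μ : ι → ℂ) (ν : ℂ)
    {p : ℕ} (h : ∀ k < p, ∑ i ∈ s, a i * μ i ^ k = ν ^ k) (c : ℂ) :
    (fun t : ℂ => ∑ i ∈ s, a i * (1 - μ i * t) ^ c - (1 - ν * t) ^ c)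
      =O[𝓝 0] fun t => t ^ p := by
  have h1 := (IsBigO.sum (s := s) fun i _ =>
    (isBigO_one_sub_mul_cpow_sub_sum c (μ i) p).const_mul_left (a i)).sub
      (isBigO_one_sub_mul_cpow_sub_sum c ν p)
  refine h1.congr_left fun t => ?_
  -- The truncated binomial series cancel exactly: the `t^k` terms involve only the `k`-th moments,
  -- `k < p`.
  have h2 : ∑ i ∈ s, a i * ∑ k ∈ Finset.range p, Ring.choose c k * (-(μ i * t)) ^ k
      = ∑ k ∈ Finset.range p, Ring.choose c k * (-(ν * t)) ^ k := by
    simp_rw [Finset.mul_sum]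
    rw [Finset.sum_comm]
    refine Finset.sum_congr rfl fun k hk => ?_
    rw [neg_eq_neg_one_mul, mul_pow, mul_pow, ← h k (Finset.mem_range.1 hk), Finset.sum_mul,
      Finset.mul_sum, Finset.mul_sum]
    refine Finset.sum_congr rfl fun i _ => ?_
    rw [neg_eq_neg_one_mul, mul_pow, mul_pow]
    ring
  rw [Finset.sum_apply]
  simp only [mul_sub, Finset.sum_sub_distrib, h2]
  ring

/-! ### Moments of the shift polynomial -/

/-- The polynomial `γ_0 + γ_1 (1 - ξ) + ⋯ + γ_{p-1} (1 - ξ)^(p-1)`. -/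
noncomputable def shiftPolynomial (γ : ℕ → ℂ) (p : ℕ) : Polynomial ℂ :=
  ∑ i ∈ Finset.range p, Polynomial.C (γ i) * (1 - Polynomial.X) ^ i

theorem shiftedGen_eq (ϖ : PowerSeries ℂ) (γ : ℕ → ℂ) (p : ℕ) :
    shiftedGen ϖ γ p = ϖ * (shiftPolynomial γ p : PowerSeries ℂ) := by
  rw [shiftedGen, shiftPolynomial]
  congr 1
  rw [← Polynomial.coeToPowerSeries.ringHom_apply, map_sum]
  simp

/-- Since `1 - e^u = O(u)`, truncating the series of `ξ^θ` in `1 - ξ` after `p` terms costs `O(u^p)`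
at `ξ = e^u`. -/
theorem isBigO_shiftPolynomial_eval_exp {θ : ℂ} {γ : ℕ → ℂ}
    (hγ : ∀ᶠ ξ in 𝓝 (1 : ℂ), HasSum (fun i : ℕ => γ i * (1 - ξ) ^ i) (ξ ^ θ)) (p : ℕ) :
    (fun u : ℂ => (shiftPolynomial γ p).eval (Complex.exp u) - Complex.exp (θ * u))
      =O[𝓝 0] fun u => u ^ p := by
  have ht : Tendsto (fun z : ℂ => 1 - z) (𝓝 0) (𝓝 1) := by
    have hc : Continuous fun z : ℂ => 1 - z := by fun_prop
    simpa using hc.tendsto 0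
  have hps : HasFPowerSeriesAt (fun z : ℂ => (1 - z) ^ θ)
      (FormalMultilinearSeries.ofScalars ℂ γ) 0 := by
    rw [hasFPowerSeriesAt_iff]
    filter_upwards [ht.eventually hγ] with z hz
    simpa [mul_comm] using hz
  have he : Tendsto (fun u : ℂ => 1 - Complex.exp u) (𝓝 0) (𝓝 0) := by
    have hc : Continuous fun u : ℂ => 1 - Complex.exp u := by fun_prop
    simpa using hc.tendsto 0
  have h1 := ((hps.isBigO_sub_partialSum_pow p).comp_tendsto he).neg_left
  have h2 : (fun u : ℂ => 1 - Complex.exp u) =O[𝓝 0] fun u => u := by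
    have hd : DifferentiableAt ℂ (fun u : ℂ => 1 - Complex.exp u) 0 := by fun_prop
    simpa using hd.isBigO_sub
  refine (h1.congr' ?_ .rfl).trans (h2.norm_left.pow p)
  -- In this strip the principal logarithm of `e^u` is `u`, so `(e^u)^θ = e^(θu)`.
  have him : ∀ᶠ u : ℂ in 𝓝 0, u.im ∈ Set.Ioo (-Real.pi) Real.pi :=
    Complex.continuous_im.continuousAt.eventually_mem
      (Ioo_mem_nhds (by simp [Real.pi_pos]) (by simp [Real.pi_pos]))
  filter_upwards [him] with u hu
  have : Complex.exp u ^ θ = Complex.exp (θ * u) := by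
    rw [Complex.cpow_def_of_ne_zero (Complex.exp_ne_zero u), Complex.log_exp hu.1 hu.2.le, mul_comm]
  simp [FormalMultilinearSeries.partialSum, shiftPolynomial, Polynomial.eval_finsetSum, this,
    mul_comm]

theorem sum_shiftPolynomial_coeff_mul_pow {θ : ℂ} {γ : ℕ → ℂ}
    (hγ : ∀ᶠ ξ in 𝓝 (1 : ℂ), HasSum (fun i : ℕ => γ i * (1 - ξ) ^ i) (ξ ^ θ)) {p k : ℕ}
    (hk : k < p) :
    ∑ j ∈ (shiftPolynomial γ p).support, (shiftPolynomial γ p).coeff j * (j : ℂ) ^ k = θ ^ k := by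
  refine sum_mul_pow_eq_of_isBigO_exp _ _ _ θ
    ((isBigO_shiftPolynomial_eval_exp hγ p).congr_left fun u => ?_) hk
  simp [Polynomial.eval_eq_sum, Polynomial.sum_def, Complex.exp_nat_mul]

/-! ### The quadrature error as a coefficient asymptotic -/

/-- The generating function of the samples `m ^ (β - 1)`, `m = 0, 1, 2, …`. -/
noncomputable def powerSamples (β : ℂ) : PowerSeries ℂ :=
  PowerSeries.mk fun m => (m : ℂ) ^ (β - 1)

/-- The shift cancels in the sample points, which are `(n-j)h`; homogeneity of the power then
extracts `h^(β-1)`. -/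
theorem convPart_powerFun (α : ℂ) (θ : ℝ) (ω : PowerSeries ℂ) {h : ℝ} (hh : 0 < h) (n : ℕ)
    (β : ℂ) : convPart α θ ω h n (powerFun β)
      = (h : ℂ) ^ (α + β - 1) * PowerSeries.coeff n (ω * powerSamples β) := by
  have h0 : (h : ℂ) ≠ 0 := by exact_mod_cast hh.ne'
  rw [convPart, PowerSeries.coeff_mul, Finset.Nat.sum_antidiagonal_eq_sum_range_succ_mk,
    add_sub_assoc, Complex.cpow_add _ _ h0, mul_assoc]
  congr 1
  rw [Finset.mul_sum]
  refine Finset.sum_congr rfl fun j hj => ?_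
  have hjn : j ≤ n := Nat.lt_succ_iff.1 (Finset.mem_range.1 hj)
  have e : ((n : ℝ) - θ) * h + (θ - (j : ℝ)) * h = h * ((n - j : ℕ) : ℝ) := by
    rw [Nat.cast_sub hjn]; ring
  rw [powerFun, e, Complex.ofReal_mul, Complex.mul_cpow_ofReal_nonneg hh.le (Nat.cast_nonneg _)]
  simp only [powerSamples, PowerSeries.coeff_mk, Complex.ofReal_natCast]
  ring

theorem rlPower_one {α β : ℂ} (hβ : β ∈ admissibleExponents) :
    rlPower α β 1 = Complex.Gamma β / Complex.Gamma (α + β) := by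
  simpa using (rlPower_eq α one_pos).2 β hβ

theorem isTheta_natCast_sub_rpow (θ s : ℝ) :
    (fun n : ℕ => ((n : ℝ) - θ) ^ s) =Θ[atTop] fun n : ℕ => (n : ℝ) ^ s := by
  have hn : Tendsto (fun n : ℕ => (n : ℝ)) atTop atTop := tendsto_natCast_atTop_atTop
  refine IsTheta.rpow ?_ (.of_forall fun n => Nat.cast_nonneg n) ?_
  · filter_upwards [hn.eventually_ge_atTop θ] with n h using sub_nonneg.2 h
  · refine IsEquivalent.isTheta (IsLittleO.isEquivalent ?_)
    have : (fun _ : ℕ => -θ) =o[atTop] fun n : ℕ => (n : ℝ) :=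
      isLittleO_const_left.2 (.inr (tendsto_norm_atTop_atTop.comp hn))
    refine this.congr_left fun n => ?_
    simp

theorem IsBigO.rpow_add_rpow_congr {u v : ℕ → ℝ} {a b : ℝ}
    (hv : ∀ᶠ n in atTop, 0 < v n)
    (ha : (fun n => u n ^ a) =O[atTop] fun n => v n ^ a)
    (hb : (fun n => u n ^ b) =O[atTop] fun n => v n ^ b) :
    (fun n => u n ^ a + u n ^ b) =O[atTop] fun n => v n ^ a + v n ^ b := by
  refine IsBigO.add (ha.trans ?_) (hb.trans ?_) <;>
  · refine IsBigO.of_bound 1 ?_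
    filter_upwards [hv] with n hn
    have h1 := Real.rpow_pos_of_pos hn a
    have h2 := Real.rpow_pos_of_pos hn b
    rw [one_mul, Real.norm_of_nonneg (by linarith), Real.norm_of_nonneg (by linarith)]
    linarith

/-- Multiply by `h^(-(α+β-1)) = (n-θ)^(α+β-1)`. The rates on the right can be written without `θ`
because `n - θ` and `n` are of the same order, so errors for different shifts become comparable. -/
theorem isBigO_convError_iff {α β : ℂ} (hβ : β ∈ admissibleExponents) (θ : ℝ)
    (ω : PowerSeries ℂ) (p : ℕ) :
    (fun n : ℕ => convError α θ ω β n) =O[atTop]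
        (fun n : ℕ => (unitStep θ n) ^ β.re + (unitStep θ n) ^ p) ↔
      (fun n : ℕ => PowerSeries.coeff n (ω * powerSamples β)
          - Complex.Gamma β / Complex.Gamma (α + β) * (((n : ℝ) - θ : ℝ) : ℂ) ^ (α + β - 1))
        =O[atTop] fun n : ℕ => (n : ℝ) ^ (α.re - 1) + (n : ℝ) ^ ((α + β).re - 1 - p) := by
  have hpos : ∀ᶠ n : ℕ in atTop, 0 < (n : ℝ) - θ := by
    filter_upwards [tendsto_natCast_atTop_atTop.eventually_gt_atTop θ] with n h using sub_pos.2 h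
  have hpos' : ∀ᶠ n : ℕ in atTop, 0 < (n : ℝ) := by
    filter_upwards [eventually_gt_atTop 0] with n h using Nat.cast_pos.2 h
  have hΘ := IsBigO.rpow_add_rpow_congr hpos' (isTheta_natCast_sub_rpow θ (α.re - 1)).1
    (isTheta_natCast_sub_rpow θ ((α + β).re - 1 - p)).1
  have hΘ' := IsBigO.rpow_add_rpow_congr hpos (isTheta_natCast_sub_rpow θ (α.re - 1)).2
    (isTheta_natCast_sub_rpow θ ((α + β).re - 1 - p)).2
  set D : ℕ → ℂ := fun n : ℕ => PowerSeries.coeff n (ω * powerSamples β)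
          - Complex.Gamma β / Complex.Gamma (α + β) * (((n : ℝ) - θ : ℝ) : ℂ) ^ (α + β - 1)
  have key : ∀ᶠ n : ℕ in atTop, convError α θ ω β n
      = ((((n : ℝ) - θ : ℝ) : ℂ) ^ (α + β - 1))⁻¹ * D n := by
    filter_upwards [hpos] with n hn
    have hne : (((n : ℝ) - θ : ℝ) : ℂ) ^ (α + β - 1) ≠ 0 := by
      rw [Complex.cpow_ne_zero_iff]
      exact .inl (by exact_mod_cast hn.ne')
    have hinv : ((unitStep θ n : ℝ) : ℂ) ^ (α + β - 1)
        = ((((n : ℝ) - θ : ℝ) : ℂ) ^ (α + β - 1))⁻¹ := by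
      rw [unitStep, one_div, Complex.ofReal_inv, Complex.inv_cpow]
      rw [Complex.arg_ofReal_of_nonneg hn.le]
      exact Real.pi_pos.ne
    have hstep : 0 < unitStep θ n := one_div_pos.2 hn
    rw [convError, convPart_powerFun α θ ω hstep, rlPower_one hβ,
      hinv]
    simp only [D, mul_sub]
    field_simp
  have key2 : ∀ᶠ n : ℕ in atTop, (unitStep θ n) ^ β.re + (unitStep θ n) ^ p
      = (((n : ℝ) - θ) ^ ((α + β).re - 1))⁻¹ *
        (((n : ℝ) - θ) ^ (α.re - 1) + ((n : ℝ) - θ) ^ ((α + β).re - 1 - p)) := by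
    filter_upwards [hpos] with n hn
    rw [unitStep, one_div, Real.inv_rpow hn.le, inv_pow, ← Real.rpow_natCast, ← Real.rpow_neg hn.le,
      ← Real.rpow_neg hn.le, ← Real.rpow_neg hn.le, mul_add, ← Real.rpow_add hn,
      ← Real.rpow_add hn]
    congr 2 <;> simp only [Complex.add_re] <;> ring
  have hfactor : (fun n : ℕ => ((((n : ℝ) - θ : ℝ) : ℂ) ^ (α + β - 1))⁻¹) =Θ[atTop]
      fun n : ℕ => (((n : ℝ) - θ) ^ ((α + β).re - 1))⁻¹ := by
    refine IsTheta.of_norm_eventuallyEq_norm ?_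
    filter_upwards [hpos] with n hn
    rw [norm_inv, norm_inv, Complex.norm_cpow_eq_rpow_re_of_pos hn,
      Real.norm_of_nonneg (Real.rpow_nonneg hn.le _)]
    simp
  rw [isBigO_congr key key2]
  constructor
  · intro h
    refine ((hfactor.inv.1.mul h).congr' ?_ ?_).trans hΘ
    · filter_upwards [hpos] with n hn
      have hne : (((n : ℝ) - θ : ℝ) : ℂ) ^ (α + β - 1) ≠ 0 := by
        rw [Complex.cpow_ne_zero_iff]
        exact .inl (by exact_mod_cast hn.ne')
      rw [inv_inv, mul_inv_cancel_left₀ hne]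
    · filter_upwards [hpos] with n hn
      rw [inv_inv, mul_inv_cancel_left₀ (Real.rpow_pos_of_pos hn _).ne']
  · intro h
    exact hfactor.1.mul (h.trans hΘ')

/-! ### Multiplication by the polynomial and conclusion -/

theorem coeff_mul_polynomial (f : PowerSeries ℂ) (Q : Polynomial ℂ) {n : ℕ}
    (hn : Q.natDegree ≤ n) :
    PowerSeries.coeff n (f * (Q : PowerSeries ℂ))
      = ∑ j ∈ Q.support, Q.coeff j * PowerSeries.coeff (n - j) f := by
  conv_lhs => rw [Q.as_sum_support_C_mul_X_pow]
  rw [← Polynomial.coeToPowerSeries.ringHom_apply, map_sum, Finset.mul_sum, map_sum]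
  refine Finset.sum_congr rfl fun j hj => ?_
  have hjn : j ≤ n := (Polynomial.le_natDegree_of_mem_supp j hj).trans hn
  simp only [map_mul, map_pow, Polynomial.coeToPowerSeries.ringHom_apply, Polynomial.coe_C,
    Polynomial.coe_X]
  rw [mul_left_comm, PowerSeries.coeff_C_mul, PowerSeries.coeff_mul_X_pow', if_pos hjn]

/-- Both factors `n` and `1 - x/n` are nonnegative reals, so the principal power is multiplicative.
-/
theorem ofReal_sub_cpow_eq {n : ℕ} (hn : 0 < n) {x : ℝ} (hx : x ≤ n) (c : ℂ) :
    (((n : ℝ) - x : ℝ) : ℂ) ^ c = (n : ℂ) ^ c * (1 - (x : ℂ) * (n : ℂ)⁻¹) ^ c := by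
  have hn' : (0 : ℝ) < n := Nat.cast_pos.2 hn
  have h1 : 0 ≤ 1 - x * (n : ℝ)⁻¹ := by
    rw [sub_nonneg, ← div_eq_mul_inv]
    exact div_le_one_of_le₀ hx hn'.le
  have h2 : (n : ℝ) - x = n * (1 - x * (n : ℝ)⁻¹) := by field_simp
  rw [h2, Complex.ofReal_mul, Complex.mul_cpow_ofReal_nonneg hn'.le h1]
  push_cast
  rfl

theorem isBigO_sum_natCast_sub_cpow {θ : ℝ} {Q : Polynomial ℂ} {p : ℕ}
    (hQ : ∀ k < p, ∑ j ∈ Q.support, Q.coeff j * (j : ℂ) ^ k = (θ : ℂ) ^ k) (c : ℂ) :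
    (fun n : ℕ => ∑ j ∈ Q.support, Q.coeff j * (((n - j : ℕ) : ℝ) : ℂ) ^ c
        - (((n : ℝ) - θ : ℝ) : ℂ) ^ c)
      =O[atTop] fun n : ℕ => (n : ℝ) ^ (c.re - p) := by
  have h1 := (isBigO_sum_cpow_sub_of_sum_mul_pow_eq Q.support Q.coeff (fun j => (j : ℂ)) (θ : ℂ)
    hQ c).comp_tendsto (tendsto_inv_atTop_nhds_zero_nat (𝕜 := ℂ))
  have h2 : (fun n : ℕ => (n : ℂ) ^ c) =O[atTop] fun n : ℕ => (n : ℝ) ^ c.re := by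
    refine IsBigO.of_bound' ?_
    filter_upwards [eventually_gt_atTop 0] with n hn
    rw [Complex.norm_natCast_cpow_of_pos hn, Real.norm_of_nonneg (by positivity)]
  refine ((h2.mul (h1.norm_right)).congr' ?_ ?_)
  · filter_upwards [eventually_gt_atTop 0, eventually_ge_atTop Q.natDegree,
      tendsto_natCast_atTop_atTop.eventually_ge_atTop θ] with n hn hd hθ
    simp only [Function.comp_apply]
    rw [mul_sub, Finset.mul_sum, ofReal_sub_cpow_eq hn hθ]
    congr 1
    refine Finset.sum_congr rfl fun j hj => ?_
    have hjn : j ≤ n := (Polynomial.le_natDegree_of_mem_supp j hj).trans hd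
    rw [Nat.cast_sub hjn, ofReal_sub_cpow_eq hn (Nat.cast_le.2 hjn)]
    push_cast
    ring
  · filter_upwards [eventually_gt_atTop 0] with n hn
    rw [Real.rpow_sub (Nat.cast_pos.2 hn)]
    simp [div_eq_mul_inv]

theorem theorem3 (α : ℂ) (θ : ℝ) (p : ℕ) (ϖ : PowerSeries ℂ)
    (hϖ : CQConvergent α ϖ p)
    (γ : ℕ → ℂ)
    (hγ : ∀ᶠ ξ in 𝓝 (1 : ℂ), HasSum (fun i : ℕ => γ i * (1 - ξ) ^ i) (ξ ^ (θ : ℂ))) :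
    SCQConvergent α θ (shiftedGen ϖ γ p) p := by
  intro β hβ
  set Q := shiftPolynomial γ p with hQ
  have hD := (isBigO_convError_iff hβ 0 ϖ p).1 (hϖ β hβ)
  rw [isBigO_convError_iff hβ]
  -- The unshifted error at index `n - j` obeys the same rate in `n`: a fixed integer delay is a
  -- shift by `θ = j`.
  have hshift (j : ℕ) := (hD.comp_tendsto (tendsto_sub_atTop_nat j)).trans
    (IsBigO.rpow_add_rpow_congr (u := fun n : ℕ => ((n - j : ℕ) : ℝ)) (v := fun n : ℕ => (n : ℝ))
      (a := α.re - 1) (b := (α + β).re - 1 - p)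
      (by filter_upwards [eventually_gt_atTop 0] with n hn using Nat.cast_pos.2 hn)
      ((isTheta_natCast_sub_rpow j _).1.congr' (by
        filter_upwards [eventually_ge_atTop j] with n hn
        rw [Nat.cast_sub hn]) .rfl)
      ((isTheta_natCast_sub_rpow j _).1.congr' (by
        filter_upwards [eventually_ge_atTop j] with n hn
        rw [Nat.cast_sub hn]) .rfl))
  have hsum := IsBigO.sum (s := Q.support) fun j _ => (hshift j).const_mul_left (Q.coeff j)
  have hmain := (isBigO_sum_natCast_sub_cpow (θ := θ) (Q := Q) (p := p)
    (fun k hk => sum_shiftPolynomial_coeff_mul_pow hγ hk) (α + β - 1)).const_mul_left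
      (Complex.Gamma β / Complex.Gamma (α + β))
  have hle : (fun n : ℕ => (n : ℝ) ^ ((α + β - 1).re - p)) =O[atTop]
      fun n : ℕ => (n : ℝ) ^ (α.re - 1) + (n : ℝ) ^ ((α + β).re - 1 - p) := by
    refine IsBigO.of_bound' (.of_forall fun n => ?_)
    rw [Complex.sub_re, Complex.one_re, Real.norm_of_nonneg (by positivity),
      Real.norm_of_nonneg (by positivity)]
    exact le_add_of_nonneg_left (by positivity)
  refine (hsum.add (hmain.trans hle)).congr' ?_ .rfl
  filter_upwards [eventually_ge_atTop Q.natDegree] with n hn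
  -- Regrouping as `(ϖ · samples) · Q` makes the coefficient a combination of those controlled by
  -- `hD`; `n ≥ deg Q` keeps every index `n - j` free of truncation.
  rw [shiftedGen_eq, ← hQ, mul_right_comm, coeff_mul_polynomial _ _ hn, Finset.sum_apply]
  simp only [Function.comp_apply, sub_zero, mul_sub, Finset.sum_sub_distrib, Finset.mul_sum]
  simp only [mul_left_comm (Q.coeff _)]
  ring
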